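/- Let $\Omega=(0,1)$, $f\in L^2(\Omega)$, and let $u\in H^2(\Omega)$ be the solution of $-u''=f$ in $\Omega$, $u(0)=u(1)=0$. For an integer $N\ge 1$ put $h=1/N$, $x_i=ih$ and $K_i=(x_i,x_{i+1})$ for $0\le i<N$; the faces of the mesh are the nodes $x_0,\dots,x_N$. At an interior node, $[\![v]\!]$ is the left trace minus the right trace, $\{\!\{v\}\!\}$ is the mean of the two traces, and $n=1$; at the boundary nodes, $[\![v]\!]$ and $\{\!\{v\}\!\}$ are both the trace from inside, and $n$ is the outward normal ($-1$ at $0$ and $1$ at $1$). Let $V_h^0$ be the space of functions that are constant on each $K_i$. For $v\in V_h^0$ let $R^2v$ be the function that equals on each $K_i$ the polynomial $p_i$ of degree at most $2$ determined by $\int_{K_j}p_i=\int_{K_j}v$ for every mesh cell $K_j$ among $K_{i-1},K_i,K_{i+1}$, together with $p_i(0)=0$ if $i=0$ and $p_i(1)=0$ if $i=N-1$ (these replace the condition on the missing neighbour). Let $U_h^2=R^2V_h^0$. With the broken derivative $v'$ taken cell by cell, set $$\|v\|_{\mathrm{sip}}^2=\sum_{i=0}^{N-1}\|v'\|_{L^2(K_i)}^2+\sum_{j=0}^{N}\frac1h[\![v]\!]_{x_j}^2,\qquad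 \|v\|_{\mathrm{sip},*}^2=\|v\|_{\mathrm{sip}}^2+\sum_{i=0}^{N-1}\Big(|(v|_{K_i})'(x_i)|^2+|(v|_{K_i})'(x_{i+1})|^2\Big),$$ and, for a penalty parameter $\eta\in(-\tfrac32,5)$, $$a_h(w,v)=\sum_{i=0}^{N-1}\int_{K_i}w'v'\,dx-\sum_{j=0}^{N}\{\!\{w'\}\!\}_{x_j}n_j[\![v]\!]_{x_j}-\sum_{j=0}^{N}[\![w]\!]_{x_j}\{\!\{v'\}\!\}_{x_j}n_j+\sum_{j=0}^{N}\frac{\eta}{h}[\![w]\!]_{x_j}[\![v]\!]_{x_j}.$$ Let $u_h\in U_h^2$ be a solution of $a_h(u_h,v)=\int_0^1 f v\,dx$ for all $v\in V_h^0$. Then there is a constant $C>0$, depending only on $\eta$ (in particular independent of $h$, $f$, $u$ and $u_h$), such that $$\|u-u_h\|_{\mathrm{sip}}\le C\inf_{v_h\in U_h^2}\|u-v_h\|_{\mathrm{sip},*}.$$ -/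

import Mathlib

open MeasureTheory Set Filter Topology
open scoped ContDiff Polynomial

noncomputable section

namespace RDG

/-! ### Sobolev spaces on an interval

Functions on an interval are represented by real functions on the line. Every notion below depends
only on the values almost everywhere inside the interval concerned. -/

/-- `w` is a weak derivative of `v` on the open interval `(a, b)`. -/
def IsWeakDeriv (a b : ℝ) (v w : ℝ → ℝ) : Prop :=
  LocallyIntegrableOn v (Ioo a b) ∧ LocallyIntegrableOn w (Ioo a b) ∧
    ∀ φ : ℝ → ℝ, ContDiff ℝ ∞ φ → HasCompactSupport φ → tsupport φ ⊆ Ioo a b →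
      ∫ x in Ioo a b, v x * deriv φ x = -∫ x in Ioo a b, w x * φ x

open Classical in
/-- The weak derivative of `v` on `(a, b)` (unique up to null sets; `0` if there is none). -/
def weakDeriv (a b : ℝ) (v : ℝ → ℝ) : ℝ → ℝ :=
  if hv : ∃ w, IsWeakDeriv a b v w then hv.choose else 0

/-- The Sobolev space `H^s(a, b)`: square integrable functions whose weak derivatives up to order
`s` exist and are square integrable. -/
def MemH : ℕ → ℝ → ℝ → (ℝ → ℝ) → Prop
  | 0, a, b, v => MemLp v 2 (volume.restrict (Ioo a b))
  | s + 1, a, b, v => MemLp v 2 (volume.restrict (Ioo a b)) ∧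
      ∃ w, IsWeakDeriv a b v w ∧ MemH s a b w

/-- The trace at `a` of a function on an interval to the right of `a`, as the limit of its averages
over `(a, a + r)`. For an `H^1` function it is the value at `a` of the continuous representative. -/
def traceFromRight (a : ℝ) (v : ℝ → ℝ) : ℝ :=
  limUnder (𝓝[>] (0 : ℝ)) fun r => r⁻¹ * ∫ x in Ioo a (a + r), v x

/-- The trace at `b` of a function on an interval to the left of `b`. -/
def traceFromLeft (b : ℝ) (v : ℝ → ℝ) : ℝ :=
  limUnder (𝓝[>] (0 : ℝ)) fun r => r⁻¹ * ∫ x in Ioo (b - r) b, v x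

/-- `u ∈ H²(0, 1)` solves `-u'' = f` in `(0, 1)`, `u(0) = u(1) = 0`. -/
def IsDirichletSolution (f u : ℝ → ℝ) : Prop :=
  MemH 2 0 1 u ∧
    (∀ᵐ x ∂(volume.restrict (Ioo (0 : ℝ) 1)), -(weakDeriv 0 1 (weakDeriv 0 1 u) x) = f x) ∧
    traceFromRight 0 u = 0 ∧ traceFromLeft 1 u = 0

/-! ### The uniform mesh of `[0, 1]` with `N` cells `K_i = (x_i, x_{i+1})`, `0 ≤ i < N` -/

/-- The mesh size `h = 1 / N`. -/
def meshSize (N : ℕ) : ℝ := 1 / (N : ℝ)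

/-- The node `x_i = i h`; the faces of the mesh are the nodes `x_0, …, x_N`. -/
def node (N i : ℕ) : ℝ := (i : ℝ) * meshSize N

/-- The cell `K_i`. -/
def cell (N i : ℕ) : Set ℝ := Ioo (node N i) (node N (i + 1))

/-- The broken gradient on the cell `K_i`. -/
def cellGrad (N i : ℕ) (v : ℝ → ℝ) : ℝ → ℝ := weakDeriv (node N i) (node N (i + 1)) v

/-- The discontinuous Galerkin space `V_h^k` of piecewise polynomials of degree at most `k`. -/
def dgSpace (N k : ℕ) : Set (ℝ → ℝ) :=
  {v | ∀ i < N, ∃ p : ℝ[X], p.natDegree ≤ k ∧ ∀ x ∈ cell N i, v x = p.eval x}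

/-- `p` is the local reconstruction `R²_{K_i} v`: a polynomial of degree at most two with the same
integrals as `v` on all cells of the mesh among `K_{i-1}, K_i, K_{i+1}`, where the condition on a
virtual cell outside `[0, 1]` is replaced by the homogeneous boundary condition at that end. -/
def IsLocalReconstruction (N i : ℕ) (v : ℝ → ℝ) (p : ℝ[X]) : Prop :=
  p.natDegree ≤ 2 ∧
    (∀ j < N, j ≤ i + 1 → i ≤ j + 1 → ∫ x in cell N j, p.eval x = ∫ x in cell N j, v x) ∧
    (i = 0 → p.eval 0 = 0) ∧ (i + 1 = N → p.eval 1 = 0)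

/-- `w = R² v`, that is, `w` is on every cell the local reconstruction of `v`. -/
def IsReconstruction (N : ℕ) (v w : ℝ → ℝ) : Prop :=
  ∀ i < N, ∃ p : ℝ[X], IsLocalReconstruction N i v p ∧ ∀ x ∈ cell N i, w x = p.eval x

/-- The reduced discontinuous Galerkin space `U_h² = R² V_h⁰`. -/
def rdgSpace (N : ℕ) : Set (ℝ → ℝ) :=
  {w | ∃ v ∈ dgSpace N 0, IsReconstruction N v w}

/-! ### Interface operators

`T₁` is the cell to the left and `T₂` the cell to the right of an interior node, with unit normal
pointing from `T₁` to `T₂`. On the boundary, jump and average are the trace from inside, and the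
normal points outward. -/

/-- The unit normal of the node `x_j`. -/
def normal (j : ℕ) : ℝ := if j = 0 then -1 else 1

/-- The jump of `v` at the node `x_j`. -/
def jump (N : ℕ) (v : ℝ → ℝ) (j : ℕ) : ℝ :=
  if j = 0 then traceFromRight (node N 0) v
  else if j = N then traceFromLeft (node N N) v
  else traceFromLeft (node N j) v - traceFromRight (node N j) v

/-- The average of the broken gradient of `v` at the node `x_j`. -/
def avgGrad (N : ℕ) (v : ℝ → ℝ) (j : ℕ) : ℝ :=
  if j = 0 then traceFromRight (node N 0) (cellGrad N 0 v)
  else if j = N then traceFromLeft (node N N) (cellGrad N (N - 1) v)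
  else (traceFromLeft (node N j) (cellGrad N (j - 1) v) +
    traceFromRight (node N j) (cellGrad N j v)) / 2

/-! ### Norms, bilinear form and scheme -/

/-- The symmetric interior penalty norm. -/
def sipNorm (N : ℕ) (v : ℝ → ℝ) : ℝ :=
  Real.sqrt ((∑ i ∈ Finset.range N, ∫ x in cell N i, cellGrad N i v x ^ 2) +
    ∑ j ∈ Finset.range (N + 1), 1 / meshSize N * jump N v j ^ 2)

/-- The extended norm: the normal derivative of `v|_K` on `∂K` (two points, outward normals `-1` and
`1`) is added for every cell `K`. -/
def sipStarNorm (N : ℕ) (v : ℝ → ℝ) : ℝ :=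
  Real.sqrt (sipNorm N v ^ 2 + ∑ i ∈ Finset.range N,
    ((traceFromRight (node N i) (cellGrad N i v) * (-1)) ^ 2 +
      (traceFromLeft (node N (i + 1)) (cellGrad N i v) * 1) ^ 2))

/-- The symmetric interior penalty bilinear form with penalty parameter `η`. -/
def sipForm (η : ℝ) (N : ℕ) (u v : ℝ → ℝ) : ℝ :=
  (∑ i ∈ Finset.range N, ∫ x in cell N i, cellGrad N i u x * cellGrad N i v x)
    - (∑ j ∈ Finset.range (N + 1), avgGrad N u j * normal j * jump N v j)
    - (∑ j ∈ Finset.range (N + 1), jump N u j * (avgGrad N v j * normal j))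
    + ∑ j ∈ Finset.range (N + 1), η / meshSize N * (jump N u j * jump N v j)

/-- The load functional `l(v) = ∑_K ∫_K f v`. -/
def load (N : ℕ) (f v : ℝ → ℝ) : ℝ :=
  ∑ i ∈ Finset.range N, ∫ x in cell N i, f x * v x

/-- `uh` solves the scheme with trial space `U_h²` and test space `V_h⁰`. -/
def IsDiscreteSolution (η : ℝ) (N : ℕ) (f uh : ℝ → ℝ) : Prop :=
  uh ∈ rdgSpace N ∧ ∀ v ∈ dgSpace N 0, sipForm η N uh v = load N f v

end RDG

end

namespace RDG

theorem integral_Ioo_eq_intervalIntegral {a b : ℝ} (hab : a ≤ b) (f : ℝ → ℝ) :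
    ∫ x in Ioo a b, f x = ∫ x in a..b, f x := by
  rw [intervalIntegral.integral_of_le hab, integral_Ioc_eq_integral_Ioo]

theorem LocallyIntegrableOn.integrable_mul_test {a b : ℝ} {v φ : ℝ → ℝ}
    (hv : LocallyIntegrableOn v (Ioo a b)) (hφ : Continuous φ) (hc : HasCompactSupport φ)
    (hs : tsupport φ ⊆ Ioo a b) : IntegrableOn (fun x => v x * φ x) (Ioo a b) := by
  have h1 : IntegrableOn v (tsupport φ) := hv.integrableOn_compact_subset hs hc
  have h2 : IntegrableOn (fun x => v x * φ x) (tsupport φ) :=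
    h1.mul_continuousOn hφ.continuousOn hc
  refine IntegrableOn.mono_set (t := univ) ?_ (subset_univ _)
  rw [integrableOn_iff_integrable_of_support_subset (s := tsupport φ)] at h2
  · simpa using h2
  · intro x hx
    exact subset_tsupport φ (by simp only [Function.mem_support] at hx ⊢; exact right_ne_zero_of_mul hx)

theorem IsWeakDeriv.ae_eq {a b : ℝ} {v w w' : ℝ → ℝ} (h : IsWeakDeriv a b v w)
    (h' : IsWeakDeriv a b v w') : w =ᵐ[volume.restrict (Ioo a b)] w' := by
  have key := isOpen_Ioo.ae_eq_zero_of_integral_contDiff_smul_eq_zero (μ := volume)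
    (h.2.1.sub h'.2.1) (fun φ hφ hc hs => ?_)
  · rw [Filter.EventuallyEq, ae_restrict_iff' measurableSet_Ioo]
    filter_upwards [key] with x hx hxs
    have := hx hxs
    simp only [Pi.sub_apply] at this
    linarith
  · have e1 := h.2.2 φ hφ hc hs
    have e2 := h'.2.2 φ hφ hc hs
    have e3 : ∫ x, φ x • (w - w') x = ∫ x in Ioo a b, (w x * φ x - w' x * φ x) := by
      rw [← setIntegral_eq_integral_of_forall_compl_eq_zero (s := Ioo a b)]
      · congr 1; ext x; simp; ring
      · intro x hx
        have : φ x = 0 := image_eq_zero_of_notMem_tsupport (fun hh => hx (hs hh))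
        simp [this]
    rw [e3, integral_sub (LocallyIntegrableOn.integrable_mul_test h.2.1 hφ.continuous hc hs)
      (LocallyIntegrableOn.integrable_mul_test h'.2.1 hφ.continuous hc hs)]
    linarith

theorem ae_restrict_locallyIntegrableOn_congr {a b : ℝ} {v v' : ℝ → ℝ}
    (hv : LocallyIntegrableOn v (Ioo a b)) (h : v =ᵐ[volume.restrict (Ioo a b)] v') :
    LocallyIntegrableOn v' (Ioo a b) := by
  rw [locallyIntegrableOn_iff (isOpen_Ioo.isLocallyClosed)] at hv ⊢
  intro k hk hkc
  exact (hv k hk hkc).congr_fun_ae (ae_restrict_of_ae_restrict_of_subset hk h)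

theorem IsWeakDeriv.congr {a b : ℝ} {v v' w w' : ℝ → ℝ} (h : IsWeakDeriv a b v w)
    (hv : v =ᵐ[volume.restrict (Ioo a b)] v') (hw : w =ᵐ[volume.restrict (Ioo a b)] w') :
    IsWeakDeriv a b v' w' := by
  refine ⟨ae_restrict_locallyIntegrableOn_congr h.1 hv,
    ae_restrict_locallyIntegrableOn_congr h.2.1 hw, fun φ hφ hc hs => ?_⟩
  have e1 : ∫ x in Ioo a b, v' x * deriv φ x = ∫ x in Ioo a b, v x * deriv φ x :=
    integral_congr_ae (by filter_upwards [hv] with x hx; rw [hx])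
  have e2 : ∫ x in Ioo a b, w' x * φ x = ∫ x in Ioo a b, w x * φ x :=
    integral_congr_ae (by filter_upwards [hw] with x hx; rw [hx])
  rw [e1, e2, h.2.2 φ hφ hc hs]

theorem IsWeakDeriv.sub {a b : ℝ} {v v' w w' : ℝ → ℝ} (h : IsWeakDeriv a b v w)
    (h' : IsWeakDeriv a b v' w') : IsWeakDeriv a b (v - v') (w - w') := by
  refine ⟨h.1.sub h'.1, h.2.1.sub h'.2.1, fun φ hφ hc hs => ?_⟩
  have hd : Continuous (deriv φ) := hφ.continuous_deriv (by simp)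
  have hds : tsupport (deriv φ) ⊆ Ioo a b := (tsupport_deriv_subset).trans hs
  simp only [Pi.sub_apply, sub_mul]
  rw [integral_sub (LocallyIntegrableOn.integrable_mul_test h.1 hd hc.deriv hds)
      (LocallyIntegrableOn.integrable_mul_test h'.1 hd hc.deriv hds),
    integral_sub (LocallyIntegrableOn.integrable_mul_test h.2.1 hφ.continuous hc hs)
      (LocallyIntegrableOn.integrable_mul_test h'.2.1 hφ.continuous hc hs),
    h.2.2 φ hφ hc hs, h'.2.2 φ hφ hc hs]
  ring

theorem IsWeakDeriv.weakDeriv_ae_eq {a b : ℝ} {v w : ℝ → ℝ} (h : IsWeakDeriv a b v w) :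
    weakDeriv a b v =ᵐ[volume.restrict (Ioo a b)] w := by
  have hex : ∃ w, IsWeakDeriv a b v w := ⟨w, h⟩
  rw [weakDeriv, dif_pos hex]
  exact hex.choose_spec.ae_eq h

/-- A primitive of an integrable function has it as weak derivative. -/
theorem isWeakDeriv_primitive {a b : ℝ} (hab : a < b) {w : ℝ → ℝ} (hw : Integrable w)
    (c : ℝ) : IsWeakDeriv a b (fun x => c + ∫ t in a..x, w t) w := by
  have hcont : Continuous (fun x => c + ∫ t in a..x, w t) :=
    continuous_const.add (intervalIntegral.continuous_primitive
      (fun _ _ => hw.intervalIntegrable) a)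
  refine ⟨hcont.locallyIntegrable.locallyIntegrableOn _,
    hw.locallyIntegrable.locallyIntegrableOn _, fun φ hφ hc hs => ?_⟩
  have hφa : φ a = 0 := image_eq_zero_of_notMem_tsupport (fun hh => lt_irrefl _ (hs hh).1)
  have hφb : φ b = 0 := image_eq_zero_of_notMem_tsupport (fun hh => lt_irrefl _ (hs hh).2)
  have hI : IntervalIntegrable w volume a b := hw.intervalIntegrable
  have hac0 := hI.absolutelyContinuousOnInterval_intervalIntegral (c := a) (by simp)
  have hac : AbsolutelyContinuousOnInterval (fun x => c + ∫ t in a..x, w t) a b :=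
    ((contDiff_const (c := c) (n := 1)).contDiffOn.absolutelyContinuousOnInterval).add hac0
  have hφac : AbsolutelyContinuousOnInterval φ a b :=
    (hφ.of_le (by simp)).contDiffOn.absolutelyContinuousOnInterval
  rw [integral_Ioo_eq_intervalIntegral hab.le, integral_Ioo_eq_intervalIntegral hab.le,
    hac.integral_mul_deriv_eq_deriv_mul hφac, hφa, hφb]
  have : ∫ x in a..b, deriv (fun x => c + ∫ t in a..x, w t) x * φ x = ∫ x in a..b, w x * φ x := by
    apply intervalIntegral.integral_congr_ae
    filter_upwards [hI.ae_hasDerivAt_integral] with x hx hxm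
    rw [((hx (uIoc_subset_uIcc hxm) a (by simp)).const_add c).deriv]
  rw [this]; ring

/-- The lemma of du Bois-Reymond. -/
theorem IsWeakDeriv.ae_const {a b : ℝ} (hab : a < b) {v : ℝ → ℝ} (h : IsWeakDeriv a b v 0) :
    ∃ c : ℝ, v =ᵐ[volume.restrict (Ioo a b)] fun _ => c := by
  obtain ⟨χ, hχ, hχc, hχs, hχ1⟩ : ∃ χ : ℝ → ℝ, ContDiff ℝ ∞ χ ∧ HasCompactSupport χ ∧
      tsupport χ ⊆ Ioo a b ∧ ∫ x, χ x = 1 := by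
    let B : ContDiffBump ((a + b) / 2) := ⟨(b - a) / 8, (b - a) / 4, by linarith, by linarith⟩
    refine ⟨B.normed volume, B.contDiff_normed, B.hasCompactSupport_normed, ?_, B.integral_normed⟩
    rw [B.tsupport_normed_eq, Real.closedBall_eq_Icc]
    intro x hx
    have e : B.rOut = (b - a) / 4 := rfl
    rw [e] at hx
    exact ⟨by linarith [hx.1], by linarith [hx.2]⟩
  have hχI : Integrable χ := hχ.continuous.integrable_of_hasCompactSupport hχc
  refine ⟨∫ x in Ioo a b, v x * χ x, ?_⟩
  set c := ∫ x in Ioo a b, v x * χ x with hcdef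
  have key := isOpen_Ioo.ae_eq_zero_of_integral_contDiff_smul_eq_zero (μ := volume)
    (h.1.sub (locallyIntegrable_const c |>.locallyIntegrableOn _)) (fun φ hφ hc hs => ?_)
  · rw [Filter.EventuallyEq, ae_restrict_iff' measurableSet_Ioo]
    filter_upwards [key] with x hx hxs
    have := hx hxs
    simp only [Pi.sub_apply] at this
    linarith
  have hφI : Integrable φ := hφ.continuous.integrable_of_hasCompactSupport hc
  set m := ∫ x, φ x with hm
  let ψ : ℝ → ℝ := fun x => φ x - m * χ x
  have hψ : ContDiff ℝ ∞ ψ := hφ.sub (contDiff_const.mul hχ)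
  have hψI : Integrable ψ := hφI.sub (hχI.const_mul m)
  have hψ0 : ∫ x, ψ x = 0 := by
    rw [integral_sub hφI (hχI.const_mul m), integral_const_mul, hχ1]; simp [hm]
  have hKc : IsCompact (tsupport φ ∪ tsupport χ) := hc.isCompact.union hχc.isCompact
  have hKn : (tsupport φ ∪ tsupport χ).Nonempty := by
    rw [nonempty_iff_ne_empty]
    intro he
    have : tsupport χ = ∅ := (union_empty_iff.1 he).2
    rw [tsupport_eq_empty_iff] at this
    simp [this] at hχ1
  obtain ⟨l, hlK, hl⟩ := hKc.exists_isLeast hKn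
  obtain ⟨r, hrK, hr⟩ := hKc.exists_isGreatest hKn
  have hKs := union_subset hs hχs
  have hla : a < l := (hKs hlK).1
  have hrb : r < b := (hKs hrK).2
  have hψz : ∀ x, x ∉ Icc l r → ψ x = 0 := by
    intro x hx
    have h1 : φ x = 0 := image_eq_zero_of_notMem_tsupport
      (fun hh => hx ⟨hl (Or.inl hh), hr (Or.inl hh)⟩)
    have h2 : χ x = 0 := image_eq_zero_of_notMem_tsupport
      (fun hh => hx ⟨hl (Or.inr hh), hr (Or.inr hh)⟩)
    simp [ψ, h1, h2]
  let Ψ : ℝ → ℝ := fun x => ∫ t in Iic x, ψ t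
  have hΨd : ∀ x, HasDerivAt Ψ (ψ x) x := by
    intro x
    have e : Ψ = fun x => (∫ t in Iic a, ψ t) + ∫ t in a..x, ψ t := by
      ext y
      simp only [Ψ]
      rw [← intervalIntegral.integral_Iic_sub_Iic hψI.integrableOn hψI.integrableOn]; ring
    rw [e]
    exact (intervalIntegral.integral_hasDerivAt_right hψI.intervalIntegrable
      (hψ.continuous.stronglyMeasurableAtFilter _ _) hψ.continuous.continuousAt).const_add _
  have hΨderiv : deriv Ψ = ψ := funext fun x => (hΨd x).deriv
  have hΨ : ContDiff ℝ ∞ Ψ := by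
    rw [contDiff_infty_iff_deriv]
    exact ⟨fun x => (hΨd x).differentiableAt, hΨderiv ▸ hψ⟩
  have hΨs : tsupport Ψ ⊆ Icc l r := by
    refine closure_minimal ?_ isClosed_Icc
    intro x hx
    by_contra hxn
    apply hx
    rw [mem_Icc, not_and_or, not_le, not_le] at hxn
    rcases hxn with hxl | hxr
    · exact setIntegral_eq_zero_of_forall_eq_zero fun t ht => hψz t fun hh =>
        absurd (hh.1.trans ht) (not_le.2 hxl)
    · have : Ψ x = ∫ t, ψ t := setIntegral_eq_integral_of_forall_compl_eq_zero fun t ht =>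
        hψz t fun hh => ht (hh.2.trans hxr.le)
      rw [this, hψ0]
  have hΨc : HasCompactSupport Ψ := isCompact_Icc.of_isClosed_subset (isClosed_tsupport _) hΨs
  have h0 := h.2.2 Ψ hΨ hΨc (hΨs.trans (Icc_subset_Ioo hla hrb))
  simp only [hΨderiv, Pi.zero_apply, zero_mul, integral_zero, neg_zero] at h0
  have i1 := LocallyIntegrableOn.integrable_mul_test h.1 hφ.continuous hc hs
  have i2 := LocallyIntegrableOn.integrable_mul_test h.1 hχ.continuous hχc hχs
  have h1 : ∫ x in Ioo a b, v x * φ x = m * c := by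
    have e : ∀ x, v x * ψ x = v x * φ x - m * (v x * χ x) := fun x => by simp only [ψ]; ring
    simp only [e] at h0
    rw [integral_sub i1 (i2.const_mul m), integral_const_mul] at h0
    linarith
  have e3 : ∫ x, φ x • ((v - fun _ => c : ℝ → ℝ) x) = ∫ x in Ioo a b, (v x * φ x - c * φ x) := by
    rw [← setIntegral_eq_integral_of_forall_compl_eq_zero (s := Ioo a b)]
    · congr 1; ext x; simp; ring
    · intro x hx
      have : φ x = 0 := image_eq_zero_of_notMem_tsupport (fun hh => hx (hs hh))
      simp [this]
  have e4 : ∫ x in Ioo a b, φ x = m := setIntegral_eq_integral_of_forall_compl_eq_zero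
    fun x hx => image_eq_zero_of_notMem_tsupport (fun hh => hx (hs hh))
  rw [e3, integral_sub i1 (hφI.integrableOn.const_mul c), h1, integral_const_mul, e4]
  ring

/-- On a bounded interval, a function with an integrable weak derivative is a primitive. -/
theorem IsWeakDeriv.exists_primitive {a b : ℝ} (hab : a < b) {v w : ℝ → ℝ}
    (h : IsWeakDeriv a b v w) (hw : Integrable w) :
    ∃ c : ℝ, v =ᵐ[volume.restrict (Ioo a b)] fun x => c + ∫ t in a..x, w t := by
  obtain ⟨c, hc⟩ := IsWeakDeriv.ae_const hab
    (v := v - fun x => 0 + ∫ t in a..x, w t) (by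
      simpa using h.sub (isWeakDeriv_primitive hab hw 0))
  refine ⟨c, ?_⟩
  filter_upwards [hc] with x hx
  simp only [Pi.sub_apply] at hx
  linarith

/-- `g` is a continuously differentiable representative of `v` on `(a, b)`. -/
def HasC1Rep (a b : ℝ) (v g : ℝ → ℝ) : Prop :=
  ContDiff ℝ 1 g ∧ v =ᵐ[volume.restrict (Ioo a b)] g

theorem HasC1Rep.sub {a b : ℝ} {v v' g g' : ℝ → ℝ} (h : HasC1Rep a b v g)
    (h' : HasC1Rep a b v' g') : HasC1Rep a b (v - v') (g - g') :=
  ⟨h.1.sub h'.1, h.2.sub h'.2⟩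

theorem HasC1Rep.mono {a b a' b' : ℝ} {v g : ℝ → ℝ} (h : HasC1Rep a b v g) (ha : a ≤ a')
    (hb : b' ≤ b) : HasC1Rep a' b' v g :=
  ⟨h.1, ae_restrict_of_ae_restrict_of_subset (Ioo_subset_Ioo ha hb) h.2⟩

theorem HasC1Rep.isWeakDeriv {a b : ℝ} (hab : a < b) {v g : ℝ → ℝ} (h : HasC1Rep a b v g) :
    IsWeakDeriv a b v (deriv g) := by
  have hd : Continuous (deriv g) := h.1.continuous_deriv le_rfl
  have : IsWeakDeriv a b g (deriv g) := by
    refine ⟨h.1.continuous.locallyIntegrable.locallyIntegrableOn _,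
      hd.locallyIntegrable.locallyIntegrableOn _, fun φ hφ hc hs => ?_⟩
    have hφa : φ a = 0 := image_eq_zero_of_notMem_tsupport (fun hh => lt_irrefl _ (hs hh).1)
    have hφb : φ b = 0 := image_eq_zero_of_notMem_tsupport (fun hh => lt_irrefl _ (hs hh).2)
    rw [integral_Ioo_eq_intervalIntegral hab.le, integral_Ioo_eq_intervalIntegral hab.le,
      intervalIntegral.integral_mul_deriv_eq_deriv_mul
        (fun x _ => (h.1.differentiable one_ne_zero x).hasDerivAt)
        (fun x _ => (hφ.differentiable (by simp) x).hasDerivAt)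
        (hd.intervalIntegrable _ _)
        ((hφ.continuous_deriv (by simp)).intervalIntegrable _ _), hφa, hφb]
    ring
  exact this.congr h.2.symm ae_eq_rfl

theorem HasC1Rep.weakDeriv_ae_eq {a b : ℝ} (hab : a < b) {v g : ℝ → ℝ} (h : HasC1Rep a b v g) :
    weakDeriv a b v =ᵐ[volume.restrict (Ioo a b)] deriv g :=
  (h.isWeakDeriv hab).weakDeriv_ae_eq

theorem tendsto_average_right {g : ℝ → ℝ} (hg : Continuous g) (a : ℝ) :
    Tendsto (fun r => r⁻¹ * ∫ x in a..(a + r), g x) (𝓝[>] 0) (𝓝 (g a)) := by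
  have := (intervalIntegral.integral_hasDerivAt_right (hg.intervalIntegrable a a)
    (hg.stronglyMeasurableAtFilter _ _) hg.continuousAt).tendsto_slope_zero_right
  simpa using this

theorem tendsto_average_left {g : ℝ → ℝ} (hg : Continuous g) (b : ℝ) :
    Tendsto (fun r => r⁻¹ * ∫ x in (b - r)..b, g x) (𝓝[>] 0) (𝓝 (g b)) := by
  have := tendsto_average_right (g := fun x => g (2 * b - x)) (by fun_prop) b
  have e : 2 * b - b = b := by ring
  simp only [e] at this
  refine this.congr fun r => ?_
  rw [intervalIntegral.integral_comp_sub_left g]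
  congr 2
  all_goals ring

theorem traceFromRight_eq {a b : ℝ} (hab : a < b) {v g : ℝ → ℝ} (hg : Continuous g)
    (h : v =ᵐ[volume.restrict (Ioo a b)] g) : traceFromRight a v = g a := by
  refine Tendsto.limUnder_eq ((tendsto_average_right hg a).congr' ?_)
  filter_upwards [Ioo_mem_nhdsGT (sub_pos.2 hab)] with r hr
  rw [← integral_Ioo_eq_intervalIntegral (by linarith [hr.1])]
  congr 1
  have h' : v =ᵐ[volume.restrict (Ioo a (a + r))] g :=
    ae_restrict_of_ae_restrict_of_subset (Ioo_subset_Ioo le_rfl (by linarith [hr.2])) h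
  exact (integral_congr_ae h').symm

theorem traceFromLeft_eq {a b : ℝ} (hab : a < b) {v g : ℝ → ℝ} (hg : Continuous g)
    (h : v =ᵐ[volume.restrict (Ioo a b)] g) : traceFromLeft b v = g b := by
  refine Tendsto.limUnder_eq ((tendsto_average_left hg b).congr' ?_)
  filter_upwards [Ioo_mem_nhdsGT (sub_pos.2 hab)] with r hr
  rw [← integral_Ioo_eq_intervalIntegral (by linarith [hr.1])]
  congr 1
  have h' : v =ᵐ[volume.restrict (Ioo (b - r) b)] g :=
    ae_restrict_of_ae_restrict_of_subset (Ioo_subset_Ioo (by linarith [hr.2]) le_rfl) h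
  exact (integral_congr_ae h').symm

/-- An `H²` function on a bounded interval is continuously differentiable, and its derivative is a
primitive of its second weak derivative. -/
theorem MemH.exists_C1Rep {a b : ℝ} (hab : a < b) {u : ℝ → ℝ} (hu : MemH 2 a b u) :
    ∃ g z : ℝ → ℝ, HasC1Rep a b u g ∧ Integrable z ∧
      (∀ x y, deriv g y - deriv g x = ∫ t in x..y, z t) ∧
      weakDeriv a b (weakDeriv a b u) =ᵐ[volume.restrict (Ioo a b)] z := by
  obtain ⟨-, w, hw, -, z, hz, hz2⟩ := hu
  have hz2' : MemLp z 2 (volume.restrict (Ioo a b)) := hz2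
  have hzI : IntegrableOn z (Ioo a b) := hz2'.integrable (by norm_num)
  have ezz : (Ioo a b).indicator z =ᵐ[volume.restrict (Ioo a b)] z :=
    indicator_ae_eq_restrict measurableSet_Ioo
  set z' := (Ioo a b).indicator z with hz'
  have hzI' : Integrable z' := hzI.integrable_indicator measurableSet_Ioo
  have hzw : IsWeakDeriv a b w z' := hz.congr ae_eq_rfl ezz.symm
  obtain ⟨c, hc⟩ := hzw.exists_primitive hab hzI'
  let G : ℝ → ℝ := fun x => c + ∫ t in a..x, z' t
  have hG : Continuous G := continuous_const.add (intervalIntegral.continuous_primitive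
      (fun _ _ => hzI'.intervalIntegrable) a)
  have hGI : IntegrableOn G (Ioo a b) :=
    (hG.integrableOn_Icc (a := a) (b := b)).mono_set Ioo_subset_Icc_self
  have eGG : (Ioo a b).indicator G =ᵐ[volume.restrict (Ioo a b)] G :=
    indicator_ae_eq_restrict measurableSet_Ioo
  have hwu : IsWeakDeriv a b u ((Ioo a b).indicator G) := hw.congr ae_eq_rfl (hc.trans eGG.symm)
  obtain ⟨d, hd⟩ := hwu.exists_primitive hab (hGI.integrable_indicator measurableSet_Ioo)
  let g : ℝ → ℝ := fun x => d + ∫ t in a..x, G t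
  have hgd : ∀ x, HasDerivAt g (G x) x := fun x =>
    (intervalIntegral.integral_hasDerivAt_right (hG.intervalIntegrable _ _)
      (hG.stronglyMeasurableAtFilter _ _) hG.continuousAt).const_add _
  have hgderiv : deriv g = G := funext fun x => (hgd x).deriv
  have hgC : ContDiff ℝ 1 g :=
    contDiff_one_iff_deriv.2 ⟨fun x => (hgd x).differentiableAt, hgderiv ▸ hG⟩
  have hug : u =ᵐ[volume.restrict (Ioo a b)] g := by
    filter_upwards [hd, ae_restrict_mem measurableSet_Ioo] with x hx hxm
    rw [hx]
    simp only [g]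
    congr 1
    rw [← integral_Ioo_eq_intervalIntegral hxm.1.le, ← integral_Ioo_eq_intervalIntegral hxm.1.le]
    refine setIntegral_congr_fun measurableSet_Ioo fun t ht => ?_
    exact indicator_of_mem (Ioo_subset_Ioo le_rfl hxm.2.le ht) G
  have hrep : HasC1Rep a b u g := ⟨hgC, hug⟩
  refine ⟨g, z', hrep, hzI', fun x y => ?_, ?_⟩
  · simp only [hgderiv, G]
    rw [add_sub_add_left_eq_sub, intervalIntegral.integral_interval_sub_left
      hzI'.intervalIntegrable hzI'.intervalIntegrable]
  · refine IsWeakDeriv.weakDeriv_ae_eq (hzw.congr ?_ ae_eq_rfl)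
    have := hrep.weakDeriv_ae_eq hab
    rw [hgderiv] at this
    exact hc.trans this.symm

theorem meshSize_pos {N : ℕ} (hN : 1 ≤ N) : 0 < meshSize N := by
  unfold meshSize; positivity

theorem meshSize_le_one {N : ℕ} (hN : 1 ≤ N) : meshSize N ≤ 1 := by
  unfold meshSize
  rw [div_le_one (by positivity)]
  exact_mod_cast hN

theorem node_succ (N i : ℕ) : node N (i + 1) = node N i + meshSize N := by
  simp only [node]; push_cast; ring

theorem node_lt_node_succ {N : ℕ} (hN : 1 ≤ N) (i : ℕ) : node N i < node N (i + 1) := by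
  rw [node_succ]; linarith [meshSize_pos hN]

theorem node_zero (N : ℕ) : node N 0 = 0 := by simp [node]

theorem node_self {N : ℕ} (hN : 1 ≤ N) : node N N = 1 := by
  simp only [node, meshSize]
  field_simp

theorem node_mono {N i j : ℕ} (h : i ≤ j) : node N i ≤ node N j := by
  simp only [node, meshSize]
  gcongr

/-- Assembles, at the node `x_j`, contributions `l i` from the left end and `r i` from the right
end of the cells `K_i`. -/
noncomputable def nodeSum (N : ℕ) (l r : ℕ → ℝ) (j : ℕ) : ℝ :=
  (if j < N then l j else 0) + (if 0 < j then r (j - 1) else 0)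

theorem sum_nodeSum (N : ℕ) (l r : ℕ → ℝ) :
    ∑ j ∈ Finset.range (N + 1), nodeSum N l r j = ∑ i ∈ Finset.range N, (l i + r i) := by
  simp only [nodeSum, Finset.sum_add_distrib]
  congr 1
  · rw [Finset.sum_range_succ]
    simp only [lt_irrefl, if_false, add_zero]
    exact Finset.sum_congr rfl fun i hi => if_pos (Finset.mem_range.1 hi)
  · rw [Finset.sum_range_succ']
    simp

theorem nodeSum_mul (N : ℕ) (l r D : ℕ → ℝ) (j : ℕ) :
    nodeSum N l r j * D j = nodeSum N (fun i => l i * D i) (fun i => r i * D (i + 1)) j := by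
  rcases j with _ | j
  · simp [nodeSum, ite_mul]
  · simp [nodeSum, add_mul, ite_mul]

theorem nodeSum_sq_le (N : ℕ) (l r : ℕ → ℝ) (j : ℕ) :
    nodeSum N l r j ^ 2 ≤ nodeSum N (fun i => 2 * l i ^ 2) (fun i => 2 * r i ^ 2) j := by
  unfold nodeSum
  split_ifs <;> nlinarith [sq_nonneg (l j - r (j - 1)), sq_nonneg (l j), sq_nonneg (r (j - 1))]

theorem nodeSum_sub (N : ℕ) (l r l' r' : ℕ → ℝ) (j : ℕ) :
    nodeSum N (l - l') (r - r') j = nodeSum N l r j - nodeSum N l' r' j := by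
  unfold nodeSum
  simp only [Pi.sub_apply]
  split_ifs <;> ring

/-- The weight of a one-sided trace in the average at the node `x_j`. -/
noncomputable def nodeWeight (N j : ℕ) : ℝ := if j = 0 ∨ j = N then 1 else 1 / 2

theorem nodeWeight_nonneg (N j : ℕ) : 0 ≤ nodeWeight N j := by
  unfold nodeWeight; split_ifs <;> norm_num

theorem nodeWeight_le_one (N j : ℕ) : nodeWeight N j ≤ 1 := by
  unfold nodeWeight; split_ifs <;> norm_num

/-- The functions `g i` are continuously differentiable representatives of `v` on the cells. -/
def HasPiecewiseC1Rep (N : ℕ) (v : ℝ → ℝ) (g : ℕ → ℝ → ℝ) : Prop :=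
  ∀ i < N, HasC1Rep (node N i) (node N (i + 1)) v (g i)

theorem HasPiecewiseC1Rep.sub {N : ℕ} {v v' : ℝ → ℝ} {g g' : ℕ → ℝ → ℝ}
    (h : HasPiecewiseC1Rep N v g) (h' : HasPiecewiseC1Rep N v' g') :
    HasPiecewiseC1Rep N (v - v') (g - g') :=
  fun i hi => (h i hi).sub (h' i hi)

/-- The jump multiplied with the normal, in terms of representatives on the cells. -/
noncomputable def signedJump (N : ℕ) (g : ℕ → ℝ → ℝ) (j : ℕ) : ℝ :=
  nodeSum N (fun i => -(g i (node N i))) (fun i => g i (node N (i + 1))) j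

/-- The average of the broken gradient, in terms of representatives on the cells. -/
noncomputable def avgDeriv (N : ℕ) (g : ℕ → ℝ → ℝ) (j : ℕ) : ℝ :=
  nodeSum N (fun i => nodeWeight N i * deriv (g i) (node N i))
    (fun i => nodeWeight N (i + 1) * deriv (g i) (node N (i + 1))) j

theorem signedJump_sub (N : ℕ) (g g' : ℕ → ℝ → ℝ) (j : ℕ) :
    signedJump N (g - g') j = signedJump N g j - signedJump N g' j := by
  unfold signedJump
  rw [← nodeSum_sub]
  congr 1
  ext i
  simp only [Pi.sub_apply]
  ring

variable {N : ℕ} {v w : ℝ → ℝ} {g k : ℕ → ℝ → ℝ}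

theorem HasPiecewiseC1Rep.traceFromRight_eq (h : HasPiecewiseC1Rep N v g) {i : ℕ} (hi : i < N) :
    traceFromRight (node N i) v = g i (node N i) :=
  RDG.traceFromRight_eq (node_lt_node_succ (by omega) i) (h i hi).1.continuous (h i hi).2

theorem HasPiecewiseC1Rep.traceFromLeft_eq (h : HasPiecewiseC1Rep N v g) {i : ℕ} (hi : i < N) :
    traceFromLeft (node N (i + 1)) v = g i (node N (i + 1)) :=
  RDG.traceFromLeft_eq (node_lt_node_succ (by omega) i) (h i hi).1.continuous (h i hi).2

theorem HasPiecewiseC1Rep.cellGrad_ae_eq (h : HasPiecewiseC1Rep N v g) {i : ℕ} (hi : i < N) :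
    cellGrad N i v =ᵐ[volume.restrict (cell N i)] deriv (g i) :=
  (h i hi).weakDeriv_ae_eq (node_lt_node_succ (by omega) i)

theorem HasPiecewiseC1Rep.traceFromRight_cellGrad (h : HasPiecewiseC1Rep N v g) {i : ℕ}
    (hi : i < N) :
    traceFromRight (node N i) (cellGrad N i v) = deriv (g i) (node N i) :=
  RDG.traceFromRight_eq (node_lt_node_succ (by omega) i) ((h i hi).1.continuous_deriv le_rfl)
    (h.cellGrad_ae_eq hi)

theorem HasPiecewiseC1Rep.traceFromLeft_cellGrad (h : HasPiecewiseC1Rep N v g) {i : ℕ}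
    (hi : i < N) :
    traceFromLeft (node N (i + 1)) (cellGrad N i v) = deriv (g i) (node N (i + 1)) :=
  RDG.traceFromLeft_eq (node_lt_node_succ (by omega) i) ((h i hi).1.continuous_deriv le_rfl)
    (h.cellGrad_ae_eq hi)

theorem HasPiecewiseC1Rep.normal_mul_jump (hN : 1 ≤ N) (h : HasPiecewiseC1Rep N v g) {j : ℕ}
    (hj : j ≤ N) : normal j * jump N v j = signedJump N g j := by
  rcases j with _ | j
  · simp [normal, jump, signedJump, nodeSum, h.traceFromRight_eq (i := 0) (by omega),
      show 0 < N by omega]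
  · rcases hj.eq_or_lt with rfl | hj
    · simp [normal, jump, signedJump, nodeSum, h.traceFromLeft_eq (i := j) (by omega)]
    · simp only [normal, jump, signedJump, nodeSum, h.traceFromLeft_eq (i := j) (by omega),
        h.traceFromRight_eq hj, hj, hj.ne]
      simp
      ring

theorem HasPiecewiseC1Rep.avgGrad_eq (hN : 1 ≤ N) (h : HasPiecewiseC1Rep N v g) {j : ℕ}
    (hj : j ≤ N) : avgGrad N v j = avgDeriv N g j := by
  rcases j with _ | j
  · simp [avgGrad, avgDeriv, nodeWeight, nodeSum, h.traceFromRight_cellGrad (i := 0) (by omega),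
      show 0 < N by omega]
  · rcases hj.eq_or_lt with rfl | hj
    · simp [avgGrad, avgDeriv, nodeWeight, nodeSum,
        h.traceFromLeft_cellGrad (i := j) (by omega)]
    · simp only [avgGrad, avgDeriv, nodeWeight, nodeSum, Nat.add_sub_cancel,
        h.traceFromLeft_cellGrad (i := j) (by omega), h.traceFromRight_cellGrad hj, hj, hj.ne]
      simp
      ring

theorem normal_sq (j : ℕ) : normal j ^ 2 = 1 := by
  unfold normal; split_ifs <;> norm_num

theorem HasPiecewiseC1Rep.sipNorm_sq (hN : 1 ≤ N) (h : HasPiecewiseC1Rep N v g) :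
    sipNorm N v ^ 2 = (∑ i ∈ Finset.range N, ∫ x in cell N i, deriv (g i) x ^ 2) +
      ∑ j ∈ Finset.range (N + 1), 1 / meshSize N * signedJump N g j ^ 2 := by
  have hh := meshSize_pos hN
  rw [sipNorm, Real.sq_sqrt]
  · congr 1
    · refine Finset.sum_congr rfl fun i hi => integral_congr_ae ?_
      filter_upwards [h.cellGrad_ae_eq (Finset.mem_range.1 hi)] with x hx
      rw [hx]
    · refine Finset.sum_congr rfl fun j hj => ?_
      rw [← h.normal_mul_jump hN (Nat.lt_succ_iff.1 (Finset.mem_range.1 hj)), mul_pow, normal_sq,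
        one_mul]
  · refine add_nonneg (Finset.sum_nonneg fun i _ => integral_nonneg fun x => sq_nonneg _)
      (Finset.sum_nonneg fun j _ => by positivity)

theorem HasPiecewiseC1Rep.sipStarNorm_sq (h : HasPiecewiseC1Rep N v g) :
    sipStarNorm N v ^ 2 = sipNorm N v ^ 2 + ∑ i ∈ Finset.range N,
      (deriv (g i) (node N i) ^ 2 + deriv (g i) (node N (i + 1)) ^ 2) := by
  rw [sipStarNorm, Real.sq_sqrt]
  · congr 1
    refine Finset.sum_congr rfl fun i hi => ?_
    rw [h.traceFromRight_cellGrad (Finset.mem_range.1 hi),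
      h.traceFromLeft_cellGrad (Finset.mem_range.1 hi)]
    ring
  · refine add_nonneg (sq_nonneg _) (Finset.sum_nonneg fun i _ => ?_)
    positivity

theorem dgSpace_zero_hasPiecewiseC1Rep (hv : v ∈ dgSpace N 0) :
    ∃ V : ℕ → ℝ, (∀ i < N, ∀ x ∈ cell N i, v x = V i) ∧
      HasPiecewiseC1Rep N v fun i _ => V i := by
  choose! p hp hpv using hv
  have hV : ∀ i < N, ∀ x ∈ cell N i, v x = (p i).coeff 0 := by
    intro i hi x hx
    rw [hpv i hi x hx, Polynomial.eq_C_of_natDegree_le_zero (hp i hi)]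
    simp
  refine ⟨fun i => (p i).coeff 0, hV, fun i hi => ⟨contDiff_const, ?_⟩⟩
  exact (ae_restrict_mem measurableSet_Ioo).mono fun x hx => hV i hi x hx

theorem HasPiecewiseC1Rep.sipForm_eq (hN : 1 ≤ N) (h : HasPiecewiseC1Rep N w g) {V : ℕ → ℝ}
    (hv : HasPiecewiseC1Rep N v fun i _ => V i) (η : ℝ) :
    sipForm η N w v = ∑ j ∈ Finset.range (N + 1),
      (-avgDeriv N g j + η / meshSize N * signedJump N g j) *
        signedJump N (fun i _ => V i) j := by
  have e1 : ∑ i ∈ Finset.range N, ∫ x in cell N i, cellGrad N i w x * cellGrad N i v x = 0 := by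
    refine Finset.sum_eq_zero fun i hi => integral_eq_zero_of_ae ?_
    filter_upwards [hv.cellGrad_ae_eq (Finset.mem_range.1 hi)] with x hx
    rw [hx]
    simp
  have e2 : ∑ j ∈ Finset.range (N + 1), jump N w j * (avgGrad N v j * normal j) = 0 := by
    refine Finset.sum_eq_zero fun j hj => ?_
    rw [hv.avgGrad_eq hN (Nat.lt_succ_iff.1 (Finset.mem_range.1 hj))]
    simp [avgDeriv, nodeSum]
  rw [sipForm, e1, e2, zero_sub, sub_zero, ← Finset.sum_neg_distrib, ← Finset.sum_add_distrib]
  refine Finset.sum_congr rfl fun j hj => ?_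
  have hj' := Nat.lt_succ_iff.1 (Finset.mem_range.1 hj)
  rw [h.avgGrad_eq hN hj', ← h.normal_mul_jump hN hj', ← hv.normal_mul_jump hN hj']
  linear_combination (-(η / meshSize N * jump N w j * jump N v j)) * normal_sq j

theorem exists_quadratic {p : ℝ[X]} (hp : p.natDegree ≤ 2) (a : ℝ) {h : ℝ} (hh : h ≠ 0) :
    ∃ A B C : ℝ, ∀ x, p.eval x = A + B * ((x - a) / h) + C * ((x - a) / h) ^ 2 := by
  refine ⟨p.coeff 0 + p.coeff 1 * a + p.coeff 2 * a ^ 2, h * (p.coeff 1 + 2 * p.coeff 2 * a),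
    h ^ 2 * p.coeff 2, fun x => ?_⟩
  rw [Polynomial.eval_eq_sum_range' (n := 3) (by omega)]
  simp only [Finset.sum_range_succ, Finset.sum_range_zero]
  field_simp
  ring

theorem hasDerivAt_quadratic (A B C a h x : ℝ) :
    HasDerivAt (fun x => A + B * ((x - a) / h) + C * ((x - a) / h) ^ 2)
      ((B + 2 * C * ((x - a) / h)) / h) x := by
  have h1 : HasDerivAt (fun x : ℝ => (x - a) / h) (1 / h) x :=
    ((hasDerivAt_id x).sub_const a).div_const h
  refine (((h1.const_mul B).const_add A).add ((h1.pow 2).const_mul C)).congr_deriv ?_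
  norm_num
  ring

theorem integral_quadratic (A B C a : ℝ) {h : ℝ} (hh : h ≠ 0) (s : ℝ) :
    ∫ x in (a + s * h)..(a + s * h + h), (A + B * ((x - a) / h) + C * ((x - a) / h) ^ 2) =
      h * (A + B * (s + 1 / 2) + C * (s ^ 2 + s + 1 / 3)) := by
  have hd : ∀ x : ℝ, HasDerivAt
      (fun x => h * (A * ((x - a) / h) + B / 2 * ((x - a) / h) ^ 2 + C / 3 * ((x - a) / h) ^ 3))
      (A + B * ((x - a) / h) + C * ((x - a) / h) ^ 2) x := by
    intro x
    have h1 : HasDerivAt (fun x : ℝ => (x - a) / h) (1 / h) x :=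
      ((hasDerivAt_id x).sub_const a).div_const h
    refine ((((h1.const_mul A).add ((h1.pow 2).const_mul (B / 2))).add
      ((h1.pow 3).const_mul (C / 3))).const_mul h).congr_deriv ?_
    norm_num
    field_simp
  rw [intervalIntegral.integral_eq_sub_of_hasDerivAt (fun x _ => hd x)
    (by apply Continuous.intervalIntegrable; fun_prop)]
  have e1 : (a + s * h + h - a) / h = s + 1 := by field_simp; ring
  have e2 : (a + s * h - a) / h = s := by field_simp; ring
  rw [e1, e2]
  ring

/-- The cell averages and boundary conditions that determine the local reconstruction
`A + B t + C t²`, where `t = (x - x_i) / h`. -/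
def IsLocalQuadratic (N i : ℕ) (V : ℕ → ℝ) (A B C : ℝ) : Prop :=
  A + B / 2 + C / 3 = V i ∧ (0 < i → A - B / 2 + C / 3 = V (i - 1)) ∧
    (i + 1 < N → A + 3 / 2 * B + 7 / 3 * C = V (i + 1)) ∧
    (i = 0 → A = 0) ∧ (i + 1 = N → A + B + C = 0)

theorem IsLocalReconstruction.exists_quadratic {i : ℕ} {V : ℕ → ℝ} {p : ℝ[X]} (hi : i < N)
    (hp : IsLocalReconstruction N i v p) (hv : ∀ i < N, ∀ x ∈ cell N i, v x = V i) :
    ∃ A B C : ℝ, (∀ x, p.eval x = A + B * ((x - node N i) / meshSize N) +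
      C * ((x - node N i) / meshSize N) ^ 2) ∧ IsLocalQuadratic N i V A B C := by
  have hN : 1 ≤ N := by omega
  have hh := meshSize_pos hN
  obtain ⟨hdeg, hint, h0, h1⟩ := hp
  obtain ⟨A, B, C, hABC⟩ := RDG.exists_quadratic hdeg (node N i) hh.ne'
  refine ⟨A, B, C, hABC, ?_⟩
  have key : ∀ j < N, j ≤ i + 1 → i ≤ j + 1 → ∀ s : ℝ, (j : ℝ) = i + s →
      A + B * (s + 1 / 2) + C * (s ^ 2 + s + 1 / 3) = V j := by
    intro j hj hj1 hj2 s hs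
    have e := hint j hj hj1 hj2
    have e1 : ∫ x in cell N j, v x = meshSize N * V j := by
      rw [setIntegral_congr_fun (s := cell N j) measurableSet_Ioo (hv j hj), cell, setIntegral_const,
        measureReal_def, Real.volume_Ioo, node_succ, add_sub_cancel_left,
        ENNReal.toReal_ofReal hh.le, smul_eq_mul]
    have e2 : node N j = node N i + s * meshSize N := by
      simp only [node, hs]; ring
    rw [e1, cell, integral_Ioo_eq_intervalIntegral (node_lt_node_succ hN j).le, node_succ, e2] at e
    simp only [hABC] at e
    rw [integral_quadratic _ _ _ _ hh.ne'] at e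
    exact mul_left_cancel₀ hh.ne' e
  refine ⟨?_, fun hi0 => ?_, fun hiN => ?_, fun hi0 => ?_, fun hiN => ?_⟩
  · have := key i hi (by omega) (by omega) 0 (by simp)
    linarith
  · have := key (i - 1) (by omega) (by omega) (by omega) (-1) (by
      rw [Nat.cast_sub (by omega)]; push_cast; ring)
    linarith
  · have := key (i + 1) (by omega) (by omega) (by omega) 1 (by push_cast; ring)
    linarith
  · have := h0 hi0
    rw [hABC, hi0, node_zero] at this
    simpa using this
  · have e1 := h1 hiN
    have e2 : (1 - node N i) / meshSize N = 1 := by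
      have e3 : node N i + meshSize N = 1 := by rw [← node_succ, hiN, node_self hN]
      rw [div_eq_one_iff_eq hh.ne', ← e3, add_sub_cancel_left]
    rw [hABC, e2] at e1
    linarith

/-- A family of real numbers that is affine in `η` and coercive at `η = 0` is coercive between the
parameters at which it is nonnegative. -/
theorem coercive_of_affine {P Q S η : ℝ} (hη : η ∈ Ioo (-(3 / 2) : ℝ) 5) (h0 : S / 4 ≤ P)
    (h1 : 0 ≤ P - 3 / 2 * Q) (h2 : 0 ≤ P + 5 * Q) (hS : 0 ≤ S) :
    min (1 + 2 / 3 * η) (1 - η / 5) / 4 * S ≤ P + η * Q := by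
  obtain ⟨hη1, hη2⟩ := hη
  rcases le_total η 0 with h | h
  · have : min (1 + 2 / 3 * η) (1 - η / 5) ≤ 1 + 2 / 3 * η := min_le_left _ _
    nlinarith [mul_le_mul_of_nonneg_right this hS,
      mul_le_mul_of_nonneg_left h0 (by linarith : 0 ≤ 1 + 2 / 3 * η),
      mul_nonneg (by linarith : 0 ≤ -(2 / 3 * η)) h1]
  · have : min (1 + 2 / 3 * η) (1 - η / 5) ≤ 1 - η / 5 := min_le_right _ _
    nlinarith [mul_le_mul_of_nonneg_right this hS,
      mul_le_mul_of_nonneg_left h0 (by linarith : 0 ≤ 1 - η / 5),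
      mul_nonneg (by linarith : 0 ≤ η / 5) h2]

/-- The slopes and the deviations from the central jump values of a local reconstruction. -/
theorem IsLocalQuadratic.cases {i : ℕ} {V D : ℕ → ℝ} {A B C : ℝ} (hi : i < N)
    (h : IsLocalQuadratic N i V A B C) (hD : ∀ j, D j = nodeSum N V (-V) j) :
    let a := D i
    let b := D (i + 1)
    let X := V i - A - nodeWeight N i * a
    let Y := A + B + C - V i - nodeWeight N (i + 1) * b
    (nodeWeight N i = 1 / 2 ∧ nodeWeight N (i + 1) = 1 / 2 ∧
      B = a ∧ B + 2 * C = b ∧ X = (b - a) / 6 ∧ Y = (a - b) / 6) ∨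
    (nodeWeight N i = 1 ∧ nodeWeight N (i + 1) = 1 / 2 ∧
      B = 3 * a - b / 2 ∧ B + 2 * C = b ∧ X = 0 ∧ Y = a / 2 - b / 4) ∨
    (nodeWeight N i = 1 / 2 ∧ nodeWeight N (i + 1) = 1 ∧
      B = a ∧ B + 2 * C = 3 * b - a / 2 ∧ X = b / 2 - a / 4 ∧ Y = 0) ∨
    (nodeWeight N i = 1 ∧ nodeWeight N (i + 1) = 1 ∧
      B = 6 * a ∧ B + 2 * C = 6 * b ∧ X = 0 ∧ Y = 0) := by
  intro a b X Y
  obtain ⟨hc, hl, hr, hl0, hr0⟩ := h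
  have hw2 : nodeWeight N (i + 1) = if i + 1 = N then 1 else 1 / 2 := by simp [nodeWeight]
  have hw1 : nodeWeight N i = if i = 0 then 1 else 1 / 2 := by simp [nodeWeight, hi.ne]
  have ha : a = V i + if 0 < i then -V (i - 1) else 0 := by simp [a, hD, nodeSum, hi]
  have hb : b = (if i + 1 < N then V (i + 1) else 0) - V i := by
    simp [b, hD, nodeSum, sub_eq_add_neg]
  rcases Nat.eq_zero_or_pos i with h0 | h0
  · have e0 := hl0 h0
    rw [if_pos h0] at hw1
    rw [if_neg (by omega), add_zero] at ha
    rcases (Nat.succ_le_of_lt hi).eq_or_lt with h1 | h1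
    · have e1 := hr0 h1
      rw [if_pos (by omega)] at hw2
      rw [if_neg (by omega), zero_sub] at hb
      refine Or.inr (Or.inr (Or.inr ⟨hw1, hw2, ?_, ?_, ?_, ?_⟩)) <;>
        first | linarith | (simp only [X, Y, hw1, hw2]; linarith)
    · have e1 := hr h1
      rw [if_neg (by omega)] at hw2
      rw [if_pos (by omega)] at hb
      refine Or.inr (Or.inl ⟨hw1, hw2, ?_, ?_, ?_, ?_⟩) <;>
        first | linarith | (simp only [X, Y, hw1, hw2]; linarith)
  · have e0 := hl h0
    rw [if_neg (by omega)] at hw1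
    rw [if_pos (by omega)] at ha
    rcases (Nat.succ_le_of_lt hi).eq_or_lt with h1 | h1
    · have e1 := hr0 h1
      rw [if_pos (by omega)] at hw2
      rw [if_neg (by omega), zero_sub] at hb
      refine Or.inr (Or.inr (Or.inl ⟨hw1, hw2, ?_, ?_, ?_, ?_⟩)) <;>
        first | linarith | (simp only [X, Y, hw1, hw2]; linarith)
    · have e1 := hr h1
      rw [if_neg (by omega)] at hw2
      rw [if_pos (by omega)] at hb
      refine Or.inl ⟨hw1, hw2, ?_, ?_, ?_, ?_⟩ <;>
        first | linarith | (simp only [X, Y, hw1, hw2]; linarith)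

theorem IsLocalQuadratic.bounds {i : ℕ} {V D : ℕ → ℝ} {A B C : ℝ} (hi : i < N)
    (h : IsLocalQuadratic N i V A B C) (hD : ∀ j, D j = nodeSum N V (-V) j) :
    B ^ 2 ≤ 40 * (D i ^ 2 + D (i + 1) ^ 2) ∧
    (B + 2 * C) ^ 2 ≤ 40 * (D i ^ 2 + D (i + 1) ^ 2) ∧
    (V i - A - nodeWeight N i * D i) ^ 2 ≤ 40 * (D i ^ 2 + D (i + 1) ^ 2) ∧
    (A + B + C - V i - nodeWeight N (i + 1) * D (i + 1)) ^ 2 ≤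
      40 * (D i ^ 2 + D (i + 1) ^ 2) := by
  generalize ha : D i = a
  generalize hb : D (i + 1) = b
  have hc := h.cases hi hD
  simp only [ha, hb] at hc
  have h1 := sq_nonneg (a + b)
  have h2 := sq_nonneg (a - b)
  have h3 := sq_nonneg a
  have h4 := sq_nonneg b
  rcases hc with ⟨-, -, hB, hC, hX, hY⟩ | ⟨-, -, hB, hC, hX, hY⟩ | ⟨-, -, hB, hC, hX, hY⟩ |
    ⟨-, -, hB, hC, hX, hY⟩ <;>
  · rw [hX, hY, hC, hB]
    refine ⟨?_, ?_, ?_, ?_⟩ <;> nlinarith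

theorem IsLocalQuadratic.coercive {i : ℕ} {V D : ℕ → ℝ} {A B C η : ℝ}
    (hη : η ∈ Ioo (-(3 / 2) : ℝ) 5) (hi : i < N)
    (h : IsLocalQuadratic N i V A B C) (hD : ∀ j, D j = nodeSum N V (-V) j) :
    min (1 + 2 / 3 * η) (1 - η / 5) / 4 * (D i ^ 2 + D (i + 1) ^ 2) ≤
      (nodeWeight N i * B * D i + nodeWeight N (i + 1) * (B + 2 * C) * D (i + 1)) +
      η * -((V i - A - nodeWeight N i * D i) * D i +
        (A + B + C - V i - nodeWeight N (i + 1) * D (i + 1)) * D (i + 1)) := by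
  generalize ha : D i = a
  generalize hb : D (i + 1) = b
  have hc := h.cases hi hD
  simp only [ha, hb] at hc
  have h1 := sq_nonneg (a + b)
  have h2 := sq_nonneg (a - b)
  have h3 := sq_nonneg a
  have h4 := sq_nonneg b
  rcases hc with ⟨hw1, hw2, hB, hC, hX, hY⟩ | ⟨hw1, hw2, hB, hC, hX, hY⟩ |
    ⟨hw1, hw2, hB, hC, hX, hY⟩ | ⟨hw1, hw2, hB, hC, hX, hY⟩ <;>
  · rw [hX, hY, hC, hB, hw1, hw2]
    refine coercive_of_affine hη ?_ ?_ ?_ (by positivity) <;> nlinarith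

/-- The piecewise quadratic with coefficients `A i`, `B i`, `C i` in the local coordinates. -/
noncomputable def quad (N : ℕ) (A B C : ℕ → ℝ) (i : ℕ) (x : ℝ) : ℝ :=
  A i + B i * ((x - node N i) / meshSize N) + C i * ((x - node N i) / meshSize N) ^ 2

theorem contDiff_quad (N : ℕ) (A B C : ℕ → ℝ) (i : ℕ) : ContDiff ℝ 1 (quad N A B C i) := by
  unfold quad
  fun_prop

theorem deriv_quad (N : ℕ) (A B C : ℕ → ℝ) (i : ℕ) (x : ℝ) :
    deriv (quad N A B C i) x =
      (B i + 2 * C i * ((x - node N i) / meshSize N)) / meshSize N :=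
  (hasDerivAt_quadratic _ _ _ _ _ _).deriv

theorem quad_sub (N : ℕ) (A B C A' B' C' : ℕ → ℝ) :
    quad N (A - A') (B - B') (C - C') = quad N A B C - quad N A' B' C' := by
  ext i x
  simp only [quad, Pi.sub_apply]
  ring

theorem IsLocalQuadratic.sub {i : ℕ} {V V' : ℕ → ℝ} {A B C A' B' C' : ℝ}
    (h : IsLocalQuadratic N i V A B C) (h' : IsLocalQuadratic N i V' A' B' C') :
    IsLocalQuadratic N i (V - V') (A - A') (B - B') (C - C') := by
  obtain ⟨h1, h2, h3, h4, h5⟩ := h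
  obtain ⟨h1', h2', h3', h4', h5'⟩ := h'
  refine ⟨?_, fun hi => ?_, fun hi => ?_, fun hi => ?_, fun hi => ?_⟩
  · simp only [Pi.sub_apply]; linarith
  · have := h2 hi; have := h2' hi; simp only [Pi.sub_apply]; linarith
  · have := h3 hi; have := h3' hi; simp only [Pi.sub_apply]; linarith
  · have := h4 hi; have := h4' hi; linarith
  · have := h5 hi; have := h5' hi; linarith

theorem exists_quad_of_mem_rdgSpace (hw : w ∈ rdgSpace N) :
    ∃ v ∈ dgSpace N 0, ∃ V A B C : ℕ → ℝ, HasPiecewiseC1Rep N v (fun i _ => V i) ∧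
      (∀ i < N, IsLocalQuadratic N i V (A i) (B i) (C i)) ∧
      HasPiecewiseC1Rep N w (quad N A B C) := by
  obtain ⟨v, hv, hvw⟩ := hw
  obtain ⟨V, hV, hVrep⟩ := dgSpace_zero_hasPiecewiseC1Rep hv
  have key : ∀ i < N, ∃ A B C : ℝ, IsLocalQuadratic N i V A B C ∧ ∀ x ∈ cell N i,
      w x = A + B * ((x - node N i) / meshSize N) + C * ((x - node N i) / meshSize N) ^ 2 := by
    intro i hi
    obtain ⟨p, hp, hwp⟩ := hvw i hi
    obtain ⟨A, B, C, h1, h2⟩ := hp.exists_quadratic hi hV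
    exact ⟨A, B, C, h2, fun x hx => (hwp x hx).trans (h1 x)⟩
  choose! A B C h1 h2 using key
  refine ⟨v, hv, V, A, B, C, hVrep, h1, fun i hi => ⟨contDiff_quad N A B C i, ?_⟩⟩
  exact (ae_restrict_mem measurableSet_Ioo).mono fun x hx => h2 i hi x hx

theorem dgSpace_sub {k : ℕ} (hv : v ∈ dgSpace N k) (hw : w ∈ dgSpace N k) :
    v - w ∈ dgSpace N k := by
  intro i hi
  obtain ⟨p, hp, hpv⟩ := hv i hi
  obtain ⟨q, hq, hqw⟩ := hw i hi
  exact ⟨p - q, (Polynomial.natDegree_sub_le_of_le hp hq).trans (by simp), fun x hx => by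
    simp [hpv x hx, hqw x hx]⟩

theorem nodeSum_nodeWeight (hN : 1 ≤ N) (D : ℕ → ℝ) {j : ℕ} (hj : j ≤ N) :
    nodeSum N (fun i => nodeWeight N i * D i) (fun i => nodeWeight N (i + 1) * D (i + 1)) j =
      D j := by
  rcases j with _ | j
  · simp [nodeSum, nodeWeight, show 0 < N by omega]
  · rcases hj.eq_or_lt with rfl | hj
    · simp [nodeSum, nodeWeight]
    · have h1 : nodeWeight N (j + 1) = 1 / 2 := by simp [nodeWeight, hj.ne]
      simp only [nodeSum, if_pos hj, Nat.succ_pos, if_true, Nat.add_sub_cancel, h1]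
      ring

theorem sum_nodes_le_sum_cells (hN : 1 ≤ N) (D : ℕ → ℝ) :
    ∑ j ∈ Finset.range (N + 1), D j ^ 2 ≤ ∑ i ∈ Finset.range N, (D i ^ 2 + D (i + 1) ^ 2) := by
  rw [← sum_nodeSum N (fun i => D i ^ 2) fun i => D (i + 1) ^ 2]
  refine Finset.sum_le_sum fun j hj => ?_
  have hj' := Nat.lt_succ_iff.1 (Finset.mem_range.1 hj)
  rcases j with _ | j
  · simp [nodeSum, show 0 < N by omega]
  · have : 0 ≤ if j + 1 < N then D (j + 1) ^ 2 else 0 := by split_ifs <;> positivity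
    simpa [nodeSum] using this

theorem sum_cells_le_sum_nodes (N : ℕ) (D : ℕ → ℝ) :
    ∑ i ∈ Finset.range N, (D i ^ 2 + D (i + 1) ^ 2) ≤
      2 * ∑ j ∈ Finset.range (N + 1), D j ^ 2 := by
  rw [Finset.sum_add_distrib, two_mul]
  refine add_le_add ?_ ?_
  · rw [Finset.sum_range_succ]
    linarith [sq_nonneg (D N)]
  · rw [Finset.sum_range_succ' (fun j => D j ^ 2)]
    linarith [sq_nonneg (D 0)]

variable {V D A B C : ℕ → ℝ}

theorem meshSize_mul_avgDeriv_quad (hN : 1 ≤ N) (A B C : ℕ → ℝ) (j : ℕ) :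
    meshSize N * avgDeriv N (quad N A B C) j =
      nodeSum N (fun i => nodeWeight N i * B i)
        (fun i => nodeWeight N (i + 1) * (B i + 2 * C i)) j := by
  have hh := (meshSize_pos hN).ne'
  simp only [avgDeriv, nodeSum, deriv_quad, node_succ, sub_self, add_sub_cancel_left,
    div_self hh, zero_div]
  rw [mul_add, mul_ite, mul_ite]
  simp only [mul_zero, add_zero]
  congr 2
  all_goals field_simp

theorem signedJump_quad (hN : 1 ≤ N) (A B C : ℕ → ℝ) (hD : ∀ j, D j = nodeSum N V (-V) j)
    {j : ℕ} (hj : j ≤ N) :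
    signedJump N (quad N A B C) j =
      nodeSum N (fun i => V i - A i - nodeWeight N i * D i)
        (fun i => A i + B i + C i - V i - nodeWeight N (i + 1) * D (i + 1)) j := by
  have hh := (meshSize_pos hN).ne'
  have e1 := nodeSum_nodeWeight hN D hj
  have e2 := hD j
  simp only [signedJump, quad, node_succ, sub_self, add_sub_cancel_left, div_self hh, zero_div]
  simp only [nodeSum, Pi.neg_apply] at e1 e2 ⊢
  split_ifs at e1 e2 ⊢ <;> linarith

theorem coercive_quad {η : ℝ} (hη : η ∈ Ioo (-(3 / 2) : ℝ) 5) (hN : 1 ≤ N)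
    (hV : ∀ i < N, IsLocalQuadratic N i V (A i) (B i) (C i))
    (hD : ∀ j, D j = nodeSum N V (-V) j) :
    min (1 + 2 / 3 * η) (1 - η / 5) / 4 * ∑ j ∈ Finset.range (N + 1), D j ^ 2 ≤
      ∑ j ∈ Finset.range (N + 1), (meshSize N * avgDeriv N (quad N A B C) j -
        η * signedJump N (quad N A B C) j) * D j := by
  have hc : 0 ≤ min (1 + 2 / 3 * η) (1 - η / 5) / 4 := by
    have := hη.1; have := hη.2
    have : 0 ≤ min (1 + 2 / 3 * η) (1 - η / 5) := le_min (by linarith) (by linarith)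
    linarith
  refine (mul_le_mul_of_nonneg_left (sum_nodes_le_sum_cells hN D) hc).trans ?_
  have e : ∀ j ∈ Finset.range (N + 1), (meshSize N * avgDeriv N (quad N A B C) j -
        η * signedJump N (quad N A B C) j) * D j =
      nodeSum N (fun i => nodeWeight N i * B i * D i)
        (fun i => nodeWeight N (i + 1) * (B i + 2 * C i) * D (i + 1)) j -
      η * nodeSum N (fun i => (V i - A i - nodeWeight N i * D i) * D i)
        (fun i => (A i + B i + C i - V i - nodeWeight N (i + 1) * D (i + 1)) * D (i + 1)) j := by
    intro j hj
    rw [meshSize_mul_avgDeriv_quad hN,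
      signedJump_quad hN A B C hD (Nat.lt_succ_iff.1 (Finset.mem_range.1 hj)), sub_mul, mul_assoc η,
      nodeSum_mul, nodeSum_mul]
  rw [Finset.sum_congr rfl e, Finset.sum_sub_distrib, ← Finset.mul_sum, sum_nodeSum, sum_nodeSum,
    Finset.mul_sum, Finset.mul_sum, ← Finset.sum_sub_distrib]
  refine Finset.sum_le_sum fun i hi => ?_
  have := (hV i (Finset.mem_range.1 hi)).coercive hη (Finset.mem_range.1 hi) hD
  linarith

theorem integral_deriv_quad_sq_le (hN : 1 ≤ N) (A B C : ℕ → ℝ) (i : ℕ) :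
    ∫ x in cell N i, deriv (quad N A B C i) x ^ 2 ≤
      (B i ^ 2 + (B i + 2 * C i) ^ 2) / meshSize N := by
  have hh := meshSize_pos hN
  have hb : ∀ x ∈ cell N i, ‖deriv (quad N A B C i) x ^ 2‖ ≤
      (B i ^ 2 + (B i + 2 * C i) ^ 2) / meshSize N ^ 2 := by
    intro x hx
    rw [Real.norm_of_nonneg (sq_nonneg _), deriv_quad, div_pow]
    refine div_le_div_of_nonneg_right ?_ (sq_nonneg _)
    have h0 : 0 ≤ (x - node N i) / meshSize N := div_nonneg (by linarith [hx.1]) hh.le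
    have h1 : (x - node N i) / meshSize N ≤ 1 := by
      rw [div_le_one hh]
      have := hx.2
      rw [node_succ] at this
      linarith
    set t := (x - node N i) / meshSize N
    nlinarith [mul_nonneg h0 (sub_nonneg.2 h1), sq_nonneg (2 * C i),
      mul_nonneg (mul_nonneg h0 (sub_nonneg.2 h1)) (sq_nonneg (2 * C i)),
      mul_nonneg h0 (sq_nonneg (B i)), mul_nonneg (sub_nonneg.2 h1) (sq_nonneg (B i + 2 * C i))]
  have hvol : volume (cell N i) < ⊤ := by simp [cell]
  have := norm_setIntegral_le_of_norm_le_const hvol hb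
  rw [measureReal_def, cell, Real.volume_Ioo, node_succ, add_sub_cancel_left,
    ENNReal.toReal_ofReal hh.le] at this
  rw [cell, node_succ]
  refine (le_abs_self _).trans (this.trans_eq ?_)
  field_simp

theorem sipNorm_quad_sq_le (hN : 1 ≤ N) (hw : HasPiecewiseC1Rep N w (quad N A B C))
    (hV : ∀ i < N, IsLocalQuadratic N i V (A i) (B i) (C i))
    (hD : ∀ j, D j = nodeSum N V (-V) j) :
    sipNorm N w ^ 2 ≤ 480 / meshSize N * ∑ j ∈ Finset.range (N + 1), D j ^ 2 := by
  have hh := meshSize_pos hN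
  have e1 : ∑ i ∈ Finset.range N, ∫ x in cell N i, deriv (quad N A B C i) x ^ 2 ≤
      80 / meshSize N * ∑ i ∈ Finset.range N, (D i ^ 2 + D (i + 1) ^ 2) := by
    rw [Finset.mul_sum]
    refine Finset.sum_le_sum fun i hi => (integral_deriv_quad_sq_le hN A B C i).trans ?_
    obtain ⟨h1, h2, -, -⟩ := (hV i (Finset.mem_range.1 hi)).bounds (Finset.mem_range.1 hi) hD
    rw [div_mul_eq_mul_div]
    exact div_le_div_of_nonneg_right (by linarith) hh.le
  have e2 : ∑ j ∈ Finset.range (N + 1), signedJump N (quad N A B C) j ^ 2 ≤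
      160 * ∑ i ∈ Finset.range N, (D i ^ 2 + D (i + 1) ^ 2) := by
    refine (Finset.sum_le_sum fun j hj => ?_).trans ((sum_nodeSum N
      (fun i => 2 * (V i - A i - nodeWeight N i * D i) ^ 2)
      (fun i => 2 * (A i + B i + C i - V i - nodeWeight N (i + 1) * D (i + 1)) ^ 2)).trans_le ?_)
    · rw [signedJump_quad hN A B C hD (Nat.lt_succ_iff.1 (Finset.mem_range.1 hj))]
      exact nodeSum_sq_le N _ _ j
    · rw [Finset.mul_sum]
      refine Finset.sum_le_sum fun i hi => ?_
      obtain ⟨-, -, h1, h2⟩ := (hV i (Finset.mem_range.1 hi)).bounds (Finset.mem_range.1 hi) hD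
      linarith
  have e3 := sum_cells_le_sum_nodes N D
  rw [hw.sipNorm_sq hN, ← Finset.mul_sum]
  set S := ∑ i ∈ Finset.range N, (D i ^ 2 + D (i + 1) ^ 2)
  calc _ ≤ 80 / meshSize N * S + 1 / meshSize N * (160 * S) := by gcongr
    _ = 240 / meshSize N * S := by ring
    _ ≤ 240 / meshSize N * (2 * ∑ j ∈ Finset.range (N + 1), D j ^ 2) := by gcongr
    _ = _ := by ring

theorem HasPiecewiseC1Rep.sum_avgDeriv_sq_le (h : HasPiecewiseC1Rep N v g) :
    ∑ j ∈ Finset.range (N + 1), avgDeriv N g j ^ 2 ≤ 2 * sipStarNorm N v ^ 2 := by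
  refine (Finset.sum_le_sum fun j _ => nodeSum_sq_le N _ _ j).trans ?_
  rw [sum_nodeSum, h.sipStarNorm_sq, mul_add, Finset.mul_sum]
  refine le_add_of_nonneg_of_le (by positivity) (Finset.sum_le_sum fun i _ => ?_)
  have aux : ∀ j (x : ℝ), (nodeWeight N j * x) ^ 2 ≤ x ^ 2 := by
    intro j x
    rw [mul_pow]
    exact mul_le_of_le_one_left (sq_nonneg _)
      (pow_le_one₀ (nodeWeight_nonneg N j) (nodeWeight_le_one N j))
  linarith [aux i (deriv (g i) (node N i)), aux (i + 1) (deriv (g i) (node N (i + 1)))]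

theorem HasPiecewiseC1Rep.sum_signedJump_sq_le (hN : 1 ≤ N) (h : HasPiecewiseC1Rep N v g) :
    ∑ j ∈ Finset.range (N + 1), signedJump N g j ^ 2 ≤ meshSize N * sipNorm N v ^ 2 := by
  have hh := meshSize_pos hN
  rw [h.sipNorm_sq hN, ← Finset.mul_sum, mul_add, ← mul_assoc, mul_one_div_cancel hh.ne', one_mul]
  refine le_add_of_nonneg_left (mul_nonneg hh.le (Finset.sum_nonneg fun i _ => ?_))
  exact integral_nonneg fun x => sq_nonneg _

theorem HasPiecewiseC1Rep.sipNorm_sq_le_sipStarNorm_sq (h : HasPiecewiseC1Rep N v g) :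
    sipNorm N v ^ 2 ≤ sipStarNorm N v ^ 2 := by
  rw [h.sipStarNorm_sq]
  exact le_add_of_nonneg_right (Finset.sum_nonneg fun i _ => by positivity)

/-- Boundedness of the bilinear form, with a weighted Young inequality. -/
theorem HasPiecewiseC1Rep.sum_flux_mul_le (hN : 1 ≤ N) (h : HasPiecewiseC1Rep N v g) (η : ℝ)
    (D : ℕ → ℝ) {c : ℝ} (hc : 0 < c) :
    ∑ j ∈ Finset.range (N + 1), (meshSize N * avgDeriv N g j - η * signedJump N g j) * D j ≤
      c / 2 * ∑ j ∈ Finset.range (N + 1), D j ^ 2 +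
        (2 + η ^ 2) / c * (meshSize N * sipStarNorm N v ^ 2) := by
  have hh := meshSize_pos hN
  have hh1 := meshSize_le_one hN
  have e1 : ∀ j, (meshSize N * avgDeriv N g j - η * signedJump N g j) * D j ≤
      c / 2 * D j ^ 2 + 1 / c * (meshSize N * avgDeriv N g j ^ 2 + η ^ 2 * signedJump N g j ^ 2) := by
    intro j
    have y1 : ∀ x y : ℝ, x * y ≤ c / 2 * y ^ 2 + 1 / c * (x ^ 2 / 2) := by
      intro x y
      have : 0 ≤ 1 / (2 * c) * (c * y - x) ^ 2 := by positivity
      have e : 1 / (2 * c) * (c * y - x) ^ 2 =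
        c / 2 * y ^ 2 + 1 / c * (x ^ 2 / 2) - x * y := by field_simp; ring
      linarith
    refine (y1 _ _).trans ?_
    gcongr
    have : meshSize N ^ 2 * avgDeriv N g j ^ 2 ≤ meshSize N * avgDeriv N g j ^ 2 :=
      mul_le_mul_of_nonneg_right (by nlinarith) (sq_nonneg _)
    nlinarith [sq_nonneg (meshSize N * avgDeriv N g j + η * signedJump N g j)]
  refine (Finset.sum_le_sum fun j _ => e1 j).trans ?_
  rw [Finset.sum_add_distrib, ← Finset.mul_sum, ← Finset.mul_sum, Finset.sum_add_distrib,
    ← Finset.mul_sum, ← Finset.mul_sum]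
  have a1 := h.sum_avgDeriv_sq_le
  have a2 := (h.sum_signedJump_sq_le hN).trans
    (mul_le_mul_of_nonneg_left h.sipNorm_sq_le_sipStarNorm_sq hh.le)
  refine add_le_add le_rfl ?_
  calc _ ≤ 1 / c * (meshSize N * (2 * sipStarNorm N v ^ 2) +
        η ^ 2 * (meshSize N * sipStarNorm N v ^ 2)) := by gcongr
    _ = _ := by ring

theorem sipNorm_sub_sq_le (hN : 1 ≤ N) (h : HasPiecewiseC1Rep N v g)
    (h' : HasPiecewiseC1Rep N w k) :
    sipNorm N (v - w) ^ 2 ≤ 2 * sipNorm N v ^ 2 + 2 * sipNorm N w ^ 2 := by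
  have hh := meshSize_pos hN
  rw [(h.sub h').sipNorm_sq hN, h.sipNorm_sq hN, h'.sipNorm_sq hN, mul_add, mul_add,
    add_add_add_comm]
  simp only [Finset.mul_sum]
  rw [← Finset.sum_add_distrib, ← Finset.sum_add_distrib]
  refine add_le_add (Finset.sum_le_sum fun i hi => ?_) (Finset.sum_le_sum fun j _ => ?_)
  · have hi' := Finset.mem_range.1 hi
    have c1 : Continuous (deriv (g i)) := (h i hi').1.continuous_deriv le_rfl
    have c2 : Continuous (deriv (k i)) := (h' i hi').1.continuous_deriv le_rfl
    have int : ∀ f : ℝ → ℝ, Continuous f → IntegrableOn f (cell N i) := fun f hf =>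
      (hf.integrableOn_Icc).mono_set Ioo_subset_Icc_self
    rw [← integral_const_mul, ← integral_const_mul,
      ← integral_add (int _ (by fun_prop)) (int _ (by fun_prop))]
    have e : deriv ((g - k) i) = deriv (g i) - deriv (k i) := funext fun x =>
      deriv_sub ((h i hi').1.differentiable one_ne_zero x)
        ((h' i hi').1.differentiable one_ne_zero x)
    rw [e]
    refine integral_mono (int _ ?_) (int _ (by fun_prop)) fun x => ?_
    · simp only [Pi.sub_apply]; fun_prop
    · simp only [Pi.sub_apply]
      nlinarith [sq_nonneg (deriv (g i) x + deriv (k i) x)]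
  · rw [signedJump_sub]
    have : 0 ≤ 1 / meshSize N * (signedJump N g j + signedJump N k j) ^ 2 := by positivity
    linarith

theorem HasC1Rep.hasPiecewiseC1Rep {u g : ℝ → ℝ} (h : HasC1Rep 0 1 u g) :
    HasPiecewiseC1Rep N u fun _ => g := by
  intro i hi
  refine h.mono ?_ ?_
  · rw [← node_zero N]; exact node_mono (by omega)
  · rw [← node_self (N := N) (by omega)]; exact node_mono (by omega)

theorem cell_subset {i : ℕ} (hi : i < N) : cell N i ⊆ Ioo 0 1 := by
  refine Ioo_subset_Ioo ?_ ?_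
  · rw [← node_zero N]; exact node_mono (by omega)
  · rw [← node_self (N := N) (by omega)]; exact node_mono (by omega)

/-- Consistency of the scheme. -/
theorem IsDirichletSolution.sipForm_eq_load {f u : ℝ → ℝ} (hN : 1 ≤ N)
    (hu : IsDirichletSolution f u) (η : ℝ) (hv : v ∈ dgSpace N 0) :
    (∃ g, HasPiecewiseC1Rep N u g) ∧ sipForm η N u v = load N f v := by
  obtain ⟨hH, hf, hu0, hu1⟩ := hu
  obtain ⟨g, z, hg, hz, hgz, hzu⟩ := hH.exists_C1Rep one_pos
  have hrep : HasPiecewiseC1Rep N u fun _ => g := hg.hasPiecewiseC1Rep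
  refine ⟨⟨_, hrep⟩, ?_⟩
  rw [traceFromRight_eq one_pos hg.1.continuous hg.2] at hu0
  rw [traceFromLeft_eq one_pos hg.1.continuous hg.2] at hu1
  obtain ⟨V, hV, hVrep⟩ := dgSpace_zero_hasPiecewiseC1Rep hv
  have hJ : ∀ j ≤ N, signedJump N (fun _ => g) j = 0 := by
    intro j hj
    rcases j with _ | j
    · simp [signedJump, nodeSum, node_zero, hu0]
    · rcases hj.eq_or_lt with rfl | hj
      · simp [signedJump, nodeSum, node_self, hu1]
      · simp [signedJump, nodeSum, hj]
  have hA : ∀ j ≤ N, avgDeriv N (fun _ => g) j = deriv g (node N j) := fun j hj =>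
    nodeSum_nodeWeight hN (fun j => deriv g (node N j)) hj
  have hfz : ∀ᵐ x ∂(volume.restrict (Ioo (0 : ℝ) 1)), f x = -z x := by
    filter_upwards [hf, hzu] with x h1 h2
    rw [← h1, h2]
  rw [hrep.sipForm_eq hN hVrep]
  have e : ∀ j ∈ Finset.range (N + 1), (-avgDeriv N (fun _ => g) j +
      η / meshSize N * signedJump N (fun _ => g) j) * signedJump N (fun i _ => V i) j =
      nodeSum N (fun i => V i * deriv g (node N i))
        (fun i => -V i * deriv g (node N (i + 1))) j := by
    intro j hj
    have hj' := Nat.lt_succ_iff.1 (Finset.mem_range.1 hj)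
    rw [hJ j hj', hA j hj', ← nodeSum_mul N V (fun i => -V i) fun j => deriv g (node N j)]
    simp only [signedJump, nodeSum]
    split_ifs <;> ring
  rw [Finset.sum_congr rfl e, sum_nodeSum, load]
  refine Finset.sum_congr rfl fun i hi => ?_
  have hi' := Finset.mem_range.1 hi
  have e2 : ∫ x in cell N i, f x * v x = ∫ x in cell N i, -V i * z x := by
    refine integral_congr_ae ?_
    filter_upwards [ae_restrict_of_ae_restrict_of_subset (cell_subset hi') hfz,
      ae_restrict_mem measurableSet_Ioo] with x h1 h2
    rw [h1, hV i hi' x h2]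
    ring
  rw [e2, integral_const_mul, cell,
    integral_Ioo_eq_intervalIntegral (node_lt_node_succ hN i).le, ← hgz]
  ring

theorem signedJump_const_eq (V : ℕ → ℝ) (j : ℕ) :
    signedJump N (fun i _ => V i) j = -nodeSum N V (-V) j := by
  simp only [signedJump, nodeSum, Pi.neg_apply]
  split_ifs <;> ring

theorem HasPiecewiseC1Rep.meshSize_mul_sipForm (hN : 1 ≤ N) (h : HasPiecewiseC1Rep N w g)
    (hv : HasPiecewiseC1Rep N v fun i _ => V i) (η : ℝ) :
    meshSize N * sipForm η N w v = ∑ j ∈ Finset.range (N + 1),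
      (meshSize N * avgDeriv N g j - η * signedJump N g j) * nodeSum N V (-V) j := by
  have hh := (meshSize_pos hN).ne'
  rw [h.sipForm_eq hN hv, Finset.mul_sum]
  refine Finset.sum_congr rfl fun j _ => ?_
  rw [signedJump_const_eq]
  field_simp
  ring

theorem avgDeriv_sub (hv : HasPiecewiseC1Rep N v g) (hw : HasPiecewiseC1Rep N w k) (j : ℕ)
    (hj : j ≤ N) : avgDeriv N (g - k) j = avgDeriv N g j - avgDeriv N k j := by
  have e : ∀ i < N, ∀ x, deriv ((g - k) i) x = deriv (g i) x - deriv (k i) x := fun i hi x =>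
    deriv_sub ((hv i hi).1.differentiable one_ne_zero x) ((hw i hi).1.differentiable one_ne_zero x)
  simp only [avgDeriv, nodeSum]
  split_ifs with h1 h2 h2
  · rw [e j h1, e (j - 1) (by omega)]; ring
  · rw [e j h1]; ring
  · rw [e (j - 1) (by omega)]; ring
  · ring

theorem sipForm_sub (hN : 1 ≤ N) {u : ℝ → ℝ} (hv : HasPiecewiseC1Rep N v g)
    (hw : HasPiecewiseC1Rep N w k) (hu : HasPiecewiseC1Rep N u fun i _ => V i) (η : ℝ) :
    sipForm η N (v - w) u = sipForm η N v u - sipForm η N w u := by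
  rw [(hv.sub hw).sipForm_eq hN hu, hv.sipForm_eq hN hu, hw.sipForm_eq hN hu,
    ← Finset.sum_sub_distrib]
  refine Finset.sum_congr rfl fun j hj => ?_
  rw [avgDeriv_sub hv hw j (Nat.lt_succ_iff.1 (Finset.mem_range.1 hj)), signedJump_sub]
  ring

/-- Quasi-optimality against a single element of the trial space. -/
theorem sipNorm_sub_sq_le_sipStarNorm_sq {η : ℝ} (hη : η ∈ Ioo (-(3 / 2) : ℝ) 5) (hN : 1 ≤ N)
    {f u uh : ℝ → ℝ} (hu : IsDirichletSolution f u) (huh : IsDiscreteSolution η N f uh)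
    (hw : w ∈ rdgSpace N) :
    sipNorm N (u - uh) ^ 2 ≤
      (2 + 1920 * (2 + η ^ 2) / (min (1 + 2 / 3 * η) (1 - η / 5) / 4) ^ 2) *
        sipStarNorm N (u - w) ^ 2 := by
  have hh := meshSize_pos hN
  set c := min (1 + 2 / 3 * η) (1 - η / 5) / 4 with hc
  have hc0 : 0 < c := by
    have := hη.1; have := hη.2
    have : 0 < min (1 + 2 / 3 * η) (1 - η / 5) := lt_min (by linarith) (by linarith)
    positivity
  obtain ⟨v₁, hv₁, V₁, A₁, B₁, C₁, hV₁, hq₁, hr₁⟩ := exists_quad_of_mem_rdgSpace huh.1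
  obtain ⟨v₂, hv₂, V₂, A₂, B₂, C₂, hV₂, hq₂, hr₂⟩ := exists_quad_of_mem_rdgSpace hw
  have hv := dgSpace_sub hv₁ hv₂
  have hV : HasPiecewiseC1Rep N (v₁ - v₂) fun i _ => (V₁ - V₂) i := hV₁.sub hV₂
  have hq : ∀ i < N, IsLocalQuadratic N i (V₁ - V₂) ((A₁ - A₂) i) ((B₁ - B₂) i) ((C₁ - C₂) i) :=
    fun i hi => (hq₁ i hi).sub (hq₂ i hi)
  have hr : HasPiecewiseC1Rep N (uh - w) (quad N (A₁ - A₂) (B₁ - B₂) (C₁ - C₂)) := by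
    rw [quad_sub]; exact hr₁.sub hr₂
  obtain ⟨⟨g, hg⟩, hcons⟩ := hu.sipForm_eq_load hN η hv
  have horth : sipForm η N (uh - w) (v₁ - v₂) = sipForm η N (u - w) (v₁ - v₂) := by
    rw [sipForm_sub hN hr₁ hr₂ hV, sipForm_sub hN hg hr₂ hV, hcons, huh.2 _ hv]
  have hcoer := coercive_quad hη hN hq fun _ => rfl
  rw [← hr.meshSize_mul_sipForm hN hV, horth,
    (hg.sub hr₂).meshSize_mul_sipForm hN hV, ← hc] at hcoer
  have hbd := (hg.sub hr₂).sum_flux_mul_le hN η (nodeSum N (V₁ - V₂) (-(V₁ - V₂))) hc0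
  have hnorm := sipNorm_quad_sq_le hN hr hq fun _ => rfl
  have htri := sipNorm_sub_sq_le hN (hg.sub hr₂) hr
  rw [sub_sub_sub_cancel_right] at htri
  have hstar := (hg.sub hr₂).sipNorm_sq_le_sipStarNorm_sq
  set T := ∑ j ∈ Finset.range (N + 1), nodeSum N (V₁ - V₂) (-(V₁ - V₂)) j ^ 2
  set S := sipStarNorm N (u - w) ^ 2
  have hT : T ≤ 2 * (2 + η ^ 2) / c ^ 2 * (meshSize N * S) := by
    have h1 : c / 2 * T ≤ (2 + η ^ 2) / c * (meshSize N * S) := by linarith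
    have h2 := mul_le_mul_of_nonneg_left h1 (by positivity : 0 ≤ 2 / c)
    calc T = 2 / c * (c / 2 * T) := by field_simp
      _ ≤ _ := h2
      _ = _ := by field_simp
  have h3 : 480 / meshSize N * T ≤ 960 * (2 + η ^ 2) / c ^ 2 * S := by
    calc _ ≤ 480 / meshSize N * (2 * (2 + η ^ 2) / c ^ 2 * (meshSize N * S)) := by gcongr
      _ = _ := by field_simp; ring
  calc _ ≤ 2 * S + 2 * (960 * (2 + η ^ 2) / c ^ 2 * S) := by linarith
    _ = _ := by ring

end RDG

theorem mainTheorem3 (η : ℝ) (hη : η ∈ Set.Ioo (-(3 / 2) : ℝ) 5) :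
    ∃ C : ℝ, 0 < C ∧ ∀ N : ℕ, 1 ≤ N → ∀ f u uh : ℝ → ℝ,
      MemLp f 2 (volume.restrict (Ioo (0 : ℝ) 1)) →
      RDG.IsDirichletSolution f u →
      RDG.IsDiscreteSolution η N f uh →
      RDG.sipNorm N (u - uh) ≤ C * ⨅ v : RDG.rdgSpace N, RDG.sipStarNorm N (u - v) := by
  set K := 2 + 1920 * (2 + η ^ 2) / (min (1 + 2 / 3 * η) (1 - η / 5) / 4) ^ 2
  have hK : 0 < K := by positivity
  refine ⟨√K, Real.sqrt_pos.2 hK, fun N hN f u uh _ hu huh => ?_⟩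
  have : Nonempty (RDG.rdgSpace N) := ⟨⟨uh, huh.1⟩⟩
  rw [Real.mul_iInf_of_nonneg (Real.sqrt_nonneg K)]
  refine le_ciInf fun w => ?_
  have h := RDG.sipNorm_sub_sq_le_sipStarNorm_sq hη hN hu huh w.2
  refine le_of_sq_le_sq ?_ (mul_nonneg (Real.sqrt_nonneg K) (Real.sqrt_nonneg _))
  rw [mul_pow, Real.sq_sqrt hK.le]
  exact h
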